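/- For integers $k_1,\dots,k_n\ge 1$ with $k_n\ge 2$ let $$\zeta^{\star}(k_1,\dots,k_n)=\sum_{0<m_1\le\cdots\le m_n}\frac{1}{m_1^{k_1}\cdots m_n^{k_n}},$$ and for integers $m\ge 0$ and $k_1,\dots,k_n\ge 1$ let $$S_m(k_1,\dots,k_n)=\sum_{0\le m_1<\cdots<m_n<m}\frac{1}{(m_1+1)^{k_1}\cdots(m_n+1)^{k_n}},\qquad S^{\star}_m(k_1,\dots,k_n)=\sum_{0\le m_1\le\cdots\le m_n\le m}\frac{1}{(m_1+1)^{k_1}\cdots(m_n+1)^{k_n}},$$ both equal to $1$ for the empty index ($n=0$). Write $\{a\}^n$ for $n$ repetitions of $a$. Then for all integers $r\ge 0$ and $s\ge 1$, the series on both sides below converge absolutely and $$\zeta^{\star}(r+2,\{2\}^{s-1})=2\sum_{m=0}^{\infty}\frac{(-1)^m}{(m+1)^{2s}}\left(\sum_{i=0}^{r}S_m(\{1\}^{r-i})\,S^{\star}_m(\{1\}^{i})\right).$$ -/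

import Mathlib

open Finset

noncomputable section

/-- The summation range of the multiple zeta-star series of depth `n`:
tuples of integers `0 < m₁ ≤ ⋯ ≤ mₙ`. -/
def StarIndex (n : ℕ) : Type :=
  {m : Fin n → ℕ // (∀ i, 0 < m i) ∧ Monotone m}

/-- The term `1 / (m₁ ^ k₁ ⋯ mₙ ^ kₙ)`. -/
def mzsvTerm {n : ℕ} (k : Fin n → ℕ) (m : StarIndex n) : ℝ :=
  1 / ∏ i, (m.1 i : ℝ) ^ k i

/-- The multiple zeta-star value `ζ⋆(k₁, …, kₙ)`. -/
def mzsv {n : ℕ} (k : Fin n → ℕ) : ℝ :=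
  ∑' m : StarIndex n, mzsvTerm k m

open Classical in
/-- The finite multiple harmonic sum `S_m(k₁, …, kₙ)`, over `0 ≤ m₁ < ⋯ < mₙ < m`;
it is `1` for the empty index. -/
def harmS (m : ℕ) {n : ℕ} (k : Fin n → ℕ) : ℝ :=
  ∑ l : Fin n → Fin m with StrictMono l, 1 / ∏ i, (((l i : ℕ) : ℝ) + 1) ^ k i

open Classical in
/-- The finite multiple harmonic star sum `S⋆_m(k₁, …, kₙ)`, over `0 ≤ m₁ ≤ ⋯ ≤ mₙ ≤ m`;
it is `1` for the empty index. -/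
def harmSStar (m : ℕ) {n : ℕ} (k : Fin n → ℕ) : ℝ :=
  ∑ l : Fin n → Fin (m + 1) with Monotone l, 1 / ∏ i, (((l i : ℕ) : ℝ) + 1) ^ k i

/-- The index `(a, …, a)` with `n` entries. -/
def constIndex (n a : ℕ) : Fin n → ℕ := fun _ => a

/-- The index `(a, k₁, …, kₙ)`. -/
def consIndex {n : ℕ} (a : ℕ) (k : Fin n → ℕ) : Fin (n + 1) → ℕ :=
  Fin.cons (α := fun _ => ℕ) a k

end

noncomputable section

/-! The proof is by connected sums. Truncate the left side to `m_n ≤ N`; the claim has an exact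
finite analogue in which the m-th term of the right side is weighted by c(N, m+1), where c(N, n) =
N!²/((N-n)!(N+n)!). Let a_r(m) be the inner sum. Its generating series in X is ∏_{j≤m}(1 -
X/(j+1))⁻¹ · ∏_{j<m}(1 + X/(j+1)). Two facts carry the finite identity. First, c(N, n) = c(N+1, n)(1
- n²/(N+1)²) (`connector_succ_left`), so raising N by one trades a factor 1/(m+1)² for 1/(N+1)²;
this is the recursion of the star sum. Second, without any power of m+1 the weighted sum equals
1/N^r (`connector_sum_coeff`), by telescoping generating series; this supplies the head exponent
r+2. As N → ∞, c(N, n) → 1 with |c| ≤ 1, and a_r(m) grows like a power of log m, so dominated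
convergence gives the theorem. -/

open Classical in
/-- The finite multiple harmonic star sum over `0 < m₁ ≤ ⋯ ≤ mₙ ≤ N`. -/
def starTrunc (N : ℕ) {n : ℕ} (k : Fin n → ℕ) : ℝ :=
  ∑ l : Fin n → Fin N with Monotone l, 1 / ∏ i, (((l i : ℕ) : ℝ) + 1) ^ k i

theorem harmSStar_eq_starTrunc (m : ℕ) {n : ℕ} (k : Fin n → ℕ) :
    harmSStar m k = starTrunc (m + 1) k := rfl

/-- The tuples of `n` natural numbers less than `N`. -/
def natBox (n N : ℕ) : Finset (Fin n → ℕ) := Fintype.piFinset fun _ => range N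

theorem mem_natBox {n N : ℕ} {l : Fin n → ℕ} : l ∈ natBox n N ↔ ∀ i, l i < N := by
  simp [natBox]

/-- The summand of the finite multiple harmonic sums. -/
def harmTerm {n : ℕ} (k l : Fin n → ℕ) : ℝ := 1 / ∏ i, ((l i : ℝ) + 1) ^ k i

/-! ### Recursions for the finite sums -/

theorem harmTerm_snoc {n : ℕ} (k : Fin (n + 1) → ℕ) (l : Fin n → ℕ) (x : ℕ) :
    harmTerm k (Fin.snoc (α := fun _ => ℕ) l x) =
      1 / ((x : ℝ) + 1) ^ k (Fin.last n) * harmTerm (Fin.init k) l := by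
  simp only [harmTerm, Fin.prod_univ_castSucc, Fin.snoc_castSucc, Fin.snoc_last, Fin.init]
  rw [one_div_mul_one_div, mul_comm]

theorem strictMono_snoc_iff {n : ℕ} (l : Fin n → ℕ) (x : ℕ) :
    StrictMono (Fin.snoc (α := fun _ => ℕ) l x) ↔ StrictMono l ∧ ∀ i, l i < x := by
  constructor
  · intro h
    refine ⟨fun i j hij => ?_, fun i => ?_⟩
    · simpa using h (Fin.castSucc_lt_castSucc_iff.2 hij)
    · simpa using h (Fin.castSucc_lt_last i)
  · rintro ⟨h, hx⟩ i j hij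
    induction j using Fin.lastCases with
    | last =>
      induction i using Fin.lastCases with
      | last => exact absurd hij (lt_irrefl _)
      | cast i => simpa using hx i
    | cast j =>
      induction i using Fin.lastCases with
      | last => exact absurd hij (not_lt.2 (Fin.le_last _))
      | cast i => simpa using h (Fin.castSucc_lt_castSucc_iff.1 hij)

theorem monotone_snoc_iff {n : ℕ} (l : Fin n → ℕ) (x : ℕ) :
    Monotone (Fin.snoc (α := fun _ => ℕ) l x) ↔ Monotone l ∧ ∀ i, l i ≤ x := by
  constructor
  · intro h
    refine ⟨fun i j hij => ?_, fun i => ?_⟩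
    · simpa using h (Fin.castSucc_le_castSucc_iff.2 hij)
    · simpa using h (Fin.castSucc_lt_last i).le
  · rintro ⟨h, hx⟩ i j hij
    induction j using Fin.lastCases with
    | last =>
      induction i using Fin.lastCases with
      | last => exact le_rfl
      | cast i => simpa using hx i
    | cast j =>
      induction i using Fin.lastCases with
      | last => exact absurd hij (not_le.2 (Fin.castSucc_lt_last _))
      | cast i => simpa using h (Fin.castSucc_le_castSucc_iff.1 hij)

open Classical in
theorem harmS_eq_sum_natBox (m : ℕ) {n : ℕ} (k : Fin n → ℕ) :
    harmS m k = ∑ l ∈ natBox n m with StrictMono l, harmTerm k l := by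
  refine Finset.sum_bij (fun l _ i => (l i : ℕ)) ?_ ?_ ?_ ?_
  · intro l hl
    simp only [mem_filter, mem_univ, true_and, mem_natBox] at hl ⊢
    exact ⟨fun i => (l i).2, fun i j hij => hl hij⟩
  · intro l _ l' _ h
    funext i
    exact Fin.ext (congrFun h i)
  · intro l hl
    simp only [mem_filter, mem_natBox] at hl
    refine ⟨fun i => ⟨l i, hl.1 i⟩, ?_, rfl⟩
    simp only [mem_filter, mem_univ, true_and]
    exact fun i j hij => hl.2 hij
  · intro l _
    rfl

open Classical in
theorem starTrunc_eq_sum_natBox (N : ℕ) {n : ℕ} (k : Fin n → ℕ) :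
    starTrunc N k = ∑ l ∈ natBox n N with Monotone l, harmTerm k l := by
  refine Finset.sum_bij (fun l _ i => (l i : ℕ)) ?_ ?_ ?_ ?_
  · intro l hl
    simp only [mem_filter, mem_univ, true_and, mem_natBox] at hl ⊢
    exact ⟨fun i => (l i).2, fun i j hij => hl hij⟩
  · intro l _ l' _ h
    funext i
    exact Fin.ext (congrFun h i)
  · intro l hl
    simp only [mem_filter, mem_natBox] at hl
    refine ⟨fun i => ⟨l i, hl.1 i⟩, ?_, rfl⟩
    simp only [mem_filter, mem_univ, true_and]
    exact fun i j hij => hl.2 hij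
  · intro l _
    rfl

theorem harmS_succ (m : ℕ) {n : ℕ} (k : Fin (n + 1) → ℕ) :
    harmS (m + 1) k =
      harmS m k + 1 / ((m : ℝ) + 1) ^ k (Fin.last n) * harmS m (Fin.init k) := by
  classical
  simp only [harmS_eq_sum_natBox]
  rw [← sum_filter_add_sum_filter_not _ (fun l => l (Fin.last n) < m), mul_sum]
  congr 1
  · refine sum_congr ?_ fun _ _ => rfl
    ext l
    simp only [mem_filter, mem_natBox]
    constructor
    · rintro ⟨⟨-, h⟩, hl⟩
      exact ⟨fun i => (h.monotone (Fin.le_last i)).trans_lt hl, h⟩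
    · rintro ⟨h, h'⟩
      exact ⟨⟨fun i => (h i).trans (Nat.lt_succ_self m), h'⟩, h _⟩
  · symm
    refine Finset.sum_bij (fun l _ => Fin.snoc (α := fun _ => ℕ) l m) ?_ ?_ ?_ ?_
    · intro l hl
      simp only [mem_filter, mem_natBox, strictMono_snoc_iff, Fin.snoc_last] at hl ⊢
      refine ⟨⟨fun i => ?_, hl.2, hl.1⟩, lt_irrefl _⟩
      induction i using Fin.lastCases with
      | last => simp
      | cast i => simpa using (hl.1 i).trans (Nat.lt_succ_self m)
    · intro l _ l' _ h
      simpa using congrArg (Fin.init (α := fun _ => ℕ)) h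
    · intro l hl
      simp only [mem_filter, mem_natBox] at hl
      have hlast : l (Fin.last n) = m := by have := hl.1.1 (Fin.last n); omega
      have hsnoc : Fin.snoc (α := fun _ => ℕ) (Fin.init l) m = l := by
        rw [← hlast]; exact Fin.snoc_init_self l
      have h := hl.1.2
      rw [← hsnoc, strictMono_snoc_iff] at h
      refine ⟨Fin.init l, ?_, hsnoc⟩
      simp only [mem_filter, mem_natBox]
      exact ⟨h.2, h.1⟩
    · intro l _
      rw [harmTerm_snoc]

/-- Split by whether the largest variable takes the top value. If it does, the others may still
equal it, so their truncation stays at `N + 1`, unlike in `harmS_succ`. -/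
theorem starTrunc_succ (N : ℕ) {n : ℕ} (k : Fin (n + 1) → ℕ) :
    starTrunc (N + 1) k =
      starTrunc N k + 1 / ((N : ℝ) + 1) ^ k (Fin.last n) * starTrunc (N + 1) (Fin.init k) := by
  classical
  simp only [starTrunc_eq_sum_natBox]
  rw [← sum_filter_add_sum_filter_not _ (fun l => l (Fin.last n) < N), mul_sum]
  congr 1
  · refine sum_congr ?_ fun _ _ => rfl
    ext l
    simp only [mem_filter, mem_natBox]
    constructor
    · rintro ⟨⟨-, h⟩, hl⟩
      exact ⟨fun i => (h (Fin.le_last i)).trans_lt hl, h⟩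
    · rintro ⟨h, h'⟩
      exact ⟨⟨fun i => (h i).trans (Nat.lt_succ_self N), h'⟩, h _⟩
  · symm
    refine Finset.sum_bij (fun l _ => Fin.snoc (α := fun _ => ℕ) l N) ?_ ?_ ?_ ?_
    · intro l hl
      simp only [mem_filter, mem_natBox, monotone_snoc_iff, Fin.snoc_last] at hl ⊢
      refine ⟨⟨fun i => ?_, hl.2, fun i => Nat.lt_succ_iff.1 (hl.1 i)⟩, lt_irrefl _⟩
      induction i using Fin.lastCases with
      | last => simp
      | cast i => simpa using hl.1 i
    · intro l _ l' _ h
      simpa using congrArg (Fin.init (α := fun _ => ℕ)) h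
    · intro l hl
      simp only [mem_filter, mem_natBox] at hl
      have hlast : l (Fin.last n) = N := by have := hl.1.1 (Fin.last n); omega
      have hsnoc : Fin.snoc (α := fun _ => ℕ) (Fin.init l) N = l := by
        rw [← hlast]; exact Fin.snoc_init_self l
      have h := hl.1.2
      rw [← hsnoc, monotone_snoc_iff] at h
      refine ⟨Fin.init l, ?_, hsnoc⟩
      simp only [mem_filter, mem_natBox]
      exact ⟨fun i => Nat.lt_succ_iff.2 (h.2 i), h.1⟩
    · intro l _
      rw [harmTerm_snoc]

theorem starTrunc_zero_left {n : ℕ} (k : Fin (n + 1) → ℕ) : starTrunc 0 k = 0 := by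
  classical
  rw [starTrunc_eq_sum_natBox]
  refine sum_eq_zero fun l hl => ?_
  simp only [mem_filter, mem_natBox] at hl
  exact absurd (hl.1 0) (Nat.not_lt_zero _)

theorem harmS_zero_left {n : ℕ} (k : Fin (n + 1) → ℕ) : harmS 0 k = 0 := by
  classical
  rw [harmS_eq_sum_natBox]
  refine sum_eq_zero fun l hl => ?_
  simp only [mem_filter, mem_natBox] at hl
  exact absurd (hl.1 0) (Nat.not_lt_zero _)

theorem starTrunc_depth_zero (N : ℕ) (k : Fin 0 → ℕ) : starTrunc N k = 1 := by
  simp [starTrunc, filter_true_of_mem, Subsingleton.monotone]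

theorem harmS_depth_zero (m : ℕ) (k : Fin 0 → ℕ) : harmS m k = 1 := by
  simp [harmS, filter_true_of_mem, Subsingleton.strictMono]

theorem starTrunc_nonneg (N : ℕ) {n : ℕ} (k : Fin n → ℕ) : 0 ≤ starTrunc N k :=
  sum_nonneg fun _ _ => by positivity

theorem harmS_nonneg (m : ℕ) {n : ℕ} (k : Fin n → ℕ) : 0 ≤ harmS m k :=
  sum_nonneg fun _ _ => by positivity

theorem init_constIndex (n a : ℕ) : Fin.init (constIndex (n + 1) a) = constIndex n a := rfl

theorem init_consIndex_constIndex (a n b : ℕ) :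
    Fin.init (consIndex a (constIndex (n + 1) b)) = consIndex a (constIndex n b) := by
  funext i
  induction i using Fin.cases with
  | zero => rfl
  | succ i => rfl

theorem consIndex_constIndex_last (a n b : ℕ) :
    consIndex a (constIndex (n + 1) b) (Fin.last (n + 1)) = b := rfl

theorem harmS_const_one_succ (m j : ℕ) :
    harmS (m + 1) (constIndex (j + 1) 1) =
      harmS m (constIndex (j + 1) 1) + 1 / ((m : ℝ) + 1) * harmS m (constIndex j 1) := by
  rw [harmS_succ, init_constIndex]
  simp [constIndex]

theorem starTrunc_const_one_succ (N j : ℕ) :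
    starTrunc (N + 1) (constIndex (j + 1) 1) =
      starTrunc N (constIndex (j + 1) 1) +
        1 / ((N : ℝ) + 1) * starTrunc (N + 1) (constIndex j 1) := by
  rw [starTrunc_succ, init_constIndex]
  simp [constIndex]

theorem starTrunc_cons_zero_succ (N a : ℕ) :
    starTrunc (N + 1) (consIndex a (constIndex 0 2)) =
      starTrunc N (consIndex a (constIndex 0 2)) + 1 / ((N : ℝ) + 1) ^ a := by
  rw [starTrunc_succ, starTrunc_depth_zero]
  simp [consIndex, Fin.last]

theorem starTrunc_cons_succ_succ (N a t : ℕ) :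
    starTrunc (N + 1) (consIndex a (constIndex (t + 1) 2)) =
      starTrunc N (consIndex a (constIndex (t + 1) 2)) +
        1 / ((N : ℝ) + 1) ^ 2 * starTrunc (N + 1) (consIndex a (constIndex t 2)) := by
  rw [starTrunc_succ, init_consIndex_constIndex, consIndex_constIndex_last]

/-! ### Generating series of the inner sums -/

/-- The generating series of the sums `S_m({1}^j)`. -/
def harmGen (m : ℕ) : PowerSeries ℝ := PowerSeries.mk fun j => harmS m (constIndex j 1)

/-- The generating series of the truncated star sums of `{1}^j`. -/
def starGen (N : ℕ) : PowerSeries ℝ := PowerSeries.mk fun j => starTrunc N (constIndex j 1)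

/-- The generating series of the inner sums `∑ i, S_m({1}^(r-i)) S⋆_m({1}^i)`. -/
def innerGen (m : ℕ) : PowerSeries ℝ := starGen (m + 1) * harmGen m

theorem coeff_innerGen (m r : ℕ) :
    PowerSeries.coeff r (innerGen m) = ∑ i ∈ Finset.range (r + 1),
      harmS m (constIndex (r - i) 1) * harmSStar m (constIndex i 1) := by
  rw [innerGen, PowerSeries.coeff_mul, Finset.Nat.sum_antidiagonal_eq_sum_range_succ_mk]
  refine sum_congr rfl fun i _ => ?_
  simp only [starGen, harmGen, PowerSeries.coeff_mk, harmSStar_eq_starTrunc]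
  exact mul_comm _ _

theorem harmGen_succ (m : ℕ) :
    harmGen (m + 1) = (1 + PowerSeries.C (1 / ((m : ℝ) + 1)) * PowerSeries.X) * harmGen m := by
  ext j
  rw [add_mul, one_mul, mul_assoc, map_add, PowerSeries.coeff_C_mul]
  cases j with
  | zero => simp [harmGen, harmS_depth_zero]
  | succ j =>
    rw [PowerSeries.coeff_succ_X_mul]
    simp only [harmGen, PowerSeries.coeff_mk, harmS_const_one_succ]

theorem starGen_succ (N : ℕ) :
    (1 - PowerSeries.C (1 / ((N : ℝ) + 1)) * PowerSeries.X) * starGen (N + 1) = starGen N := by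
  ext j
  rw [sub_mul, one_mul, mul_assoc, map_sub, PowerSeries.coeff_C_mul]
  cases j with
  | zero => simp [starGen, starTrunc_depth_zero]
  | succ j =>
    rw [PowerSeries.coeff_succ_X_mul]
    simp only [starGen, PowerSeries.coeff_mk, starTrunc_const_one_succ]
    ring

theorem harmGen_zero : harmGen 0 = 1 := by
  ext j
  cases j with
  | zero => simp [harmGen, harmS_depth_zero]
  | succ j => simp [harmGen, harmS_zero_left, PowerSeries.coeff_one]

theorem starGen_zero : starGen 0 = 1 := by
  ext j
  cases j with
  | zero => simp [starGen, starTrunc_depth_zero]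
  | succ j => simp [starGen, starTrunc_zero_left, PowerSeries.coeff_one]

theorem innerGen_zero : (1 - PowerSeries.X) * innerGen 0 = 1 := by
  have h := starGen_succ 0
  rw [starGen_zero] at h
  rw [innerGen, harmGen_zero, mul_one]
  simpa using h

theorem innerGen_succ (m : ℕ) :
    (1 - PowerSeries.C (1 / ((m : ℝ) + 2)) * PowerSeries.X) * innerGen (m + 1) =
      (1 + PowerSeries.C (1 / ((m : ℝ) + 1)) * PowerSeries.X) * innerGen m := by
  have h := starGen_succ (m + 1)
  rw [show ((m + 1 : ℕ) : ℝ) + 1 = (m : ℝ) + 2 by push_cast; ring] at h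
  rw [innerGen, innerGen, harmGen_succ, ← h]
  ring

/-! ### The connector -/

/-- The connector `N!² / ((N - n)! (N + n)!)`. -/
def connector (N n : ℕ) : ℝ := ∏ j ∈ range n, ((N : ℝ) - j) / ((N : ℝ) + j + 1)

theorem connector_zero (N : ℕ) : connector N 0 = 1 := by simp [connector]

theorem connector_succ (N n : ℕ) :
    connector N (n + 1) * ((N : ℝ) + n + 1) = connector N n * ((N : ℝ) - n) := by
  have : (N : ℝ) + n + 1 ≠ 0 := by positivity
  rw [connector, prod_range_succ, ← connector]
  field_simp

theorem connector_self_succ (N : ℕ) : connector N (N + 1) = 0 := by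
  rw [connector, prod_range_succ]
  simp

/-- The factorials give the ratio (N+1)²/((N+1-n)(N+1+n)). The form without division also covers `n
> N`, where the connector vanishes. -/
theorem connector_succ_left (N n : ℕ) :
    connector N n * ((N : ℝ) + 1) ^ 2 =
      connector (N + 1) n * (((N : ℝ) + 1) ^ 2 - (n : ℝ) ^ 2) := by
  induction n with
  | zero => simp [connector_zero]
  | succ n ih =>
    have h1 : (N : ℝ) + n + 1 ≠ 0 := by positivity
    have h2 : (N : ℝ) + 1 + n + 1 ≠ 0 := by positivity
    have e1 := connector_succ N n
    have e2 := connector_succ (N + 1) n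
    push_cast at e1 e2 ⊢
    apply mul_left_cancel₀ h1
    linear_combination ((N : ℝ) + 1) ^ 2 * e1 + ((N : ℝ) - n) * ih
      - (N + n + 1) * ((N : ℝ) - n) * e2

theorem abs_connector_le_one (N n : ℕ) : |connector N n| ≤ 1 := by
  rw [connector, abs_prod]
  refine prod_le_one (fun _ _ => abs_nonneg _) fun j _ => ?_
  have h : (0 : ℝ) < (N : ℝ) + j + 1 := by positivity
  have hN : (0 : ℝ) ≤ N := N.cast_nonneg
  have hj : (0 : ℝ) ≤ j := j.cast_nonneg
  rw [abs_div, abs_of_pos h, div_le_one h, abs_le]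
  constructor <;> linarith

theorem tendsto_connector (n : ℕ) :
    Filter.Tendsto (fun N => connector N n) Filter.atTop (nhds 1) := by
  have h : ∀ j ∈ range n, Filter.Tendsto (fun N : ℕ => ((N : ℝ) - j) / ((N : ℝ) + j + 1))
      Filter.atTop (nhds 1) := by
    intro j _
    have h0 : Filter.Tendsto (fun N : ℕ => (N : ℝ) + (j + 1)) Filter.atTop Filter.atTop :=
      Filter.tendsto_atTop_add_const_right _ _ tendsto_natCast_atTop_atTop
    have h1 := (h0.const_div_atTop (2 * (j : ℝ) + 1)).const_sub 1
    rw [sub_zero] at h1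
    refine h1.congr fun N => ?_
    have : (N : ℝ) + j + 1 ≠ 0 := by positivity
    have : (N : ℝ) + (j + 1) ≠ 0 := by positivity
    field_simp
    ring
  simpa [connector] using tendsto_finsetProd _ h

/-! ### The telescoping identity -/

theorem connector_sum_partial (N M : ℕ) :
    2 * ((N : PowerSeries ℝ) - PowerSeries.X) *
      ∑ m ∈ range M, PowerSeries.C ((-1) ^ m * connector N (m + 1)) * innerGen m =
    (N : PowerSeries ℝ) - PowerSeries.C ((-1) ^ M * connector N M) *
      ((N : PowerSeries ℝ) - (M : PowerSeries ℝ)) *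
        ((1 - PowerSeries.C (1 / ((M : ℝ) + 1)) * PowerSeries.X) * innerGen M) := by
  induction M with
  | zero =>
    have := innerGen_zero
    simp [connector_zero, this]
  | succ M ih =>
    have hc : PowerSeries.C (connector N (M + 1)) * ((N : PowerSeries ℝ) + M + 1) =
        PowerSeries.C (connector N M) * ((N : PowerSeries ℝ) - M) := by
      have := congrArg (PowerSeries.C (R := ℝ)) (connector_succ N M)
      simpa using this
    have hy : PowerSeries.C (1 / ((M : ℝ) + 1)) * ((M : PowerSeries ℝ) + 1) = 1 := by
      have h : 1 / ((M : ℝ) + 1) * ((M : ℝ) + 1) = 1 := by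
        have : (M : ℝ) + 1 ≠ 0 := by positivity
        field_simp
      have := congrArg (PowerSeries.C (R := ℝ)) h
      rw [map_mul, map_add, map_natCast, map_one] at this
      exact this
    rw [sum_range_succ, mul_add, ih,
      show ((M + 1 : ℕ) : ℝ) + 1 = (M : ℝ) + 2 by push_cast; ring, innerGen_succ]
    simp only [map_mul, map_pow, map_neg, map_one, pow_succ, Nat.cast_add, Nat.cast_one]
    generalize PowerSeries.C (1 / ((M : ℝ) + 1)) = y at *
    linear_combination (-1) ^ M * (1 - y * PowerSeries.X) * innerGen M * hc
      + (-1) ^ M * PowerSeries.C (connector N (M + 1)) * 2 * PowerSeries.X * innerGen M * hy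

/-- At `M = N` the factor `N - M` kills the remainder of the telescoping sum. -/
theorem connector_sum (N : ℕ) :
    2 * ((N : PowerSeries ℝ) - PowerSeries.X) *
      ∑ m ∈ range N, PowerSeries.C ((-1) ^ m * connector N (m + 1)) * innerGen m =
        (N : PowerSeries ℝ) := by
  rw [connector_sum_partial]
  simp

theorem connector_sum_coeff (N : ℕ) (hN : N ≠ 0) (r : ℕ) :
    2 * ∑ m ∈ range N, (-1) ^ m * connector N (m + 1) * PowerSeries.coeff r (innerGen m) =
      1 / (N : ℝ) ^ r := by
  have hN' : (N : ℝ) ≠ 0 := Nat.cast_ne_zero.2 hN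
  have key := connector_sum N
  set S := ∑ m ∈ range N, PowerSeries.C ((-1) ^ m * connector N (m + 1)) * innerGen m with hS
  have hcoeff : ∀ r, PowerSeries.coeff r S =
      ∑ m ∈ range N, (-1) ^ m * connector N (m + 1) * PowerSeries.coeff r (innerGen m) := by
    intro r
    rw [hS, map_sum]
    exact sum_congr rfl fun m _ => PowerSeries.coeff_C_mul _ _ _
  have key' : PowerSeries.C (2 * (N : ℝ)) * S - PowerSeries.C 2 * (PowerSeries.X * S) =
      PowerSeries.C (N : ℝ) := by
    rw [← mul_assoc]
    simp only [map_mul, map_natCast, map_ofNat]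
    linear_combination key
  rw [← hcoeff]
  induction r with
  | zero =>
    have h := congrArg (PowerSeries.coeff 0) key'
    rw [map_sub, PowerSeries.coeff_C_mul, PowerSeries.coeff_C_mul,
      PowerSeries.coeff_zero_X_mul, PowerSeries.coeff_zero_C] at h
    apply mul_left_cancel₀ hN'
    rw [pow_zero]
    linear_combination h
  | succ r ih =>
    have h := congrArg (PowerSeries.coeff (r + 1)) key'
    rw [map_sub, PowerSeries.coeff_C_mul, PowerSeries.coeff_C_mul,
      PowerSeries.coeff_succ_X_mul, PowerSeries.coeff_C, if_neg (Nat.succ_ne_zero r)] at h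
    -- The series 2S equals N/(N - X), so each coefficient is 1/N times the previous one.
    have h2 : (N : ℝ) * (2 * PowerSeries.coeff (r + 1) S) = 1 / (N : ℝ) ^ r := by
      linear_combination h + ih
    rw [eq_div_iff (pow_ne_zero _ hN')] at h2 ⊢
    rw [pow_succ]
    linear_combination h2

/-! ### The finite identity -/

/-- The truncation at `N` of the alternating series. -/
def connectedSum (r t N : ℕ) : ℝ :=
  2 * ∑ m ∈ range N, (-1) ^ m * connector N (m + 1) * PowerSeries.coeff r (innerGen m) /
    ((m : ℝ) + 1) ^ (2 * t)

theorem connectedSum_succ (r t N : ℕ) :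
    connectedSum r (t + 1) (N + 1) =
      connectedSum r (t + 1) N + 1 / ((N : ℝ) + 1) ^ 2 * connectedSum r t (N + 1) := by
  -- The extra term `m = N` is zero because `connector N (N + 1) = 0`; both sums then have the same
  -- range.
  have h0 : connectedSum r (t + 1) N =
      2 * ∑ m ∈ range (N + 1), (-1) ^ m * connector N (m + 1) *
        PowerSeries.coeff r (innerGen m) / ((m : ℝ) + 1) ^ (2 * (t + 1)) := by
    rw [sum_range_succ, connector_self_succ, connectedSum]
    simp
  rw [h0, connectedSum, connectedSum, mul_left_comm (1 / _), ← mul_add]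
  congr 1
  rw [mul_sum, ← sum_add_distrib]
  refine sum_congr rfl fun m _ => ?_
  have h := connector_succ_left N (m + 1)
  have hm : (m : ℝ) + 1 ≠ 0 := by positivity
  have hN : (N : ℝ) + 1 ≠ 0 := by positivity
  push_cast at h
  rw [show 2 * (t + 1) = 2 * t + 2 by ring, pow_add _ (2 * t)]
  field_simp
  linear_combination -PowerSeries.coeff r (innerGen m) * h

theorem starTrunc_eq_connectedSum (r t N : ℕ) :
    starTrunc N (consIndex (r + 2) (constIndex t 2)) = connectedSum r (t + 1) N := by
  induction t generalizing N with
  | zero =>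
    induction N with
    | zero => simp [starTrunc_zero_left, connectedSum]
    | succ N ih =>
      have h : connectedSum r 0 (N + 1) = 1 / ((N : ℝ) + 1) ^ r := by
        rw [← Nat.cast_succ, ← connector_sum_coeff _ (Nat.succ_ne_zero N)]
        simp [connectedSum]
      rw [starTrunc_cons_zero_succ, connectedSum_succ, ih, h, one_div_mul_one_div, ← pow_add,
        add_comm r 2]
  | succ t iht =>
    induction N with
    | zero => simp [starTrunc_zero_left, connectedSum]
    | succ N ih => rw [starTrunc_cons_succ_succ, connectedSum_succ, ih, iht]

/-! ### Growth of the inner sums and absolute convergence -/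

theorem harmonic_cast_succ (n : ℕ) :
    (harmonic (n + 1) : ℝ) = (harmonic n : ℝ) + 1 / ((n : ℝ) + 1) := by
  rw [harmonic_succ]
  push_cast
  rw [one_div]

theorem harmonic_cast_nonneg (n : ℕ) : (0 : ℝ) ≤ (harmonic n : ℝ) := by
  induction n with
  | zero => simp
  | succ n ih =>
    rw [harmonic_cast_succ]
    positivity

theorem harmonic_cast_le_succ (n : ℕ) : (harmonic n : ℝ) ≤ (harmonic (n + 1) : ℝ) := by
  rw [harmonic_cast_succ]
  have : (0 : ℝ) ≤ 1 / ((n : ℝ) + 1) := by positivity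
  linarith

theorem harmS_const_one_le (m j : ℕ) :
    harmS m (constIndex j 1) ≤ (harmonic m : ℝ) ^ j := by
  induction m generalizing j with
  | zero =>
    cases j with
    | zero => simp [harmS_depth_zero]
    | succ j => simp [harmS_zero_left]
  | succ m ih =>
    cases j with
    | zero => simp [harmS_depth_zero]
    | succ j =>
      have h0 := harmonic_cast_nonneg m
      have h1 := harmonic_cast_nonneg (m + 1)
      have hd : (0 : ℝ) ≤ 1 / ((m : ℝ) + 1) := by positivity
      calc harmS (m + 1) (constIndex (j + 1) 1)
          = harmS m (constIndex (j + 1) 1) + 1 / ((m : ℝ) + 1) * harmS m (constIndex j 1) :=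
            harmS_const_one_succ m j
        _ ≤ (harmonic m : ℝ) ^ (j + 1) + 1 / ((m : ℝ) + 1) * (harmonic m : ℝ) ^ j :=
            add_le_add (ih _) (mul_le_mul_of_nonneg_left (ih _) hd)
        _ = (harmonic m : ℝ) ^ j * (harmonic (m + 1) : ℝ) := by
            rw [harmonic_cast_succ]; ring
        _ ≤ (harmonic (m + 1) : ℝ) ^ j * (harmonic (m + 1) : ℝ) :=
            mul_le_mul_of_nonneg_right
              (pow_le_pow_left₀ h0 (harmonic_cast_le_succ m) j) h1
        _ = _ := (pow_succ _ _).symm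

theorem starTrunc_const_one_le (N j : ℕ) :
    starTrunc N (constIndex j 1) ≤ (harmonic N : ℝ) ^ j := by
  induction j generalizing N with
  | zero => simp [starTrunc_depth_zero]
  | succ j ihj =>
    induction N with
    | zero => simp [starTrunc_zero_left]
    | succ N ih =>
      have h0 := harmonic_cast_nonneg N
      have hd : (0 : ℝ) ≤ 1 / ((N : ℝ) + 1) := by positivity
      calc starTrunc (N + 1) (constIndex (j + 1) 1)
          = starTrunc N (constIndex (j + 1) 1) +
              1 / ((N : ℝ) + 1) * starTrunc (N + 1) (constIndex j 1) :=
            starTrunc_const_one_succ N j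
        _ ≤ (harmonic N : ℝ) ^ (j + 1) + 1 / ((N : ℝ) + 1) * (harmonic (N + 1) : ℝ) ^ j :=
            add_le_add ih (mul_le_mul_of_nonneg_left (ihj _) hd)
        _ ≤ (harmonic (N + 1) : ℝ) ^ j * (harmonic N : ℝ) +
              1 / ((N : ℝ) + 1) * (harmonic (N + 1) : ℝ) ^ j := by
            rw [pow_succ]
            exact add_le_add (mul_le_mul_of_nonneg_right
              (pow_le_pow_left₀ h0 (harmonic_cast_le_succ N) j) h0) le_rfl
        _ = (harmonic (N + 1) : ℝ) ^ (j + 1) := by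
            rw [pow_succ]
            nth_rewrite 4 [harmonic_cast_succ]
            ring

theorem coeff_innerGen_nonneg (m r : ℕ) : 0 ≤ PowerSeries.coeff r (innerGen m) := by
  rw [coeff_innerGen]
  exact sum_nonneg fun i _ => mul_nonneg (harmS_nonneg _ _) (starTrunc_nonneg _ _)

theorem coeff_innerGen_le (m r : ℕ) :
    PowerSeries.coeff r (innerGen m) ≤ ((r : ℝ) + 1) * (harmonic (m + 1) : ℝ) ^ r := by
  have h : ∀ i ∈ range (r + 1),
      harmS m (constIndex (r - i) 1) * harmSStar m (constIndex i 1) ≤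
        (harmonic (m + 1) : ℝ) ^ r := by
    intro i hi
    have hi' : r - i + i = r := Nat.sub_add_cancel (Nat.lt_succ_iff.1 (mem_range.1 hi))
    calc harmS m (constIndex (r - i) 1) * harmSStar m (constIndex i 1)
        ≤ (harmonic (m + 1) : ℝ) ^ (r - i) * (harmonic (m + 1) : ℝ) ^ i := by
          refine mul_le_mul ((harmS_const_one_le _ _).trans ?_) (starTrunc_const_one_le _ _)
            (starTrunc_nonneg _ _) (pow_nonneg (harmonic_cast_nonneg _) _)
          exact pow_le_pow_left₀ (harmonic_cast_nonneg m) (harmonic_cast_le_succ m) _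
      _ = _ := by rw [← pow_add, hi']
  rw [coeff_innerGen]
  refine (sum_le_card_nsmul _ _ _ h).trans_eq ?_
  simp

theorem exists_harmonic_pow_le (r : ℕ) :
    ∃ K : ℝ, ∀ m : ℕ, (harmonic (m + 1) : ℝ) ^ r ≤ K * ((m : ℝ) + 1) ^ (1 / 2 : ℝ) := by
  -- Chosen so that `ε * r ≤ 1 / 2`; any total exponent below 1 would leave a summable series after
  -- division by (m+1)².
  set ε : ℝ := 1 / (2 * ((r : ℝ) + 1)) with hε
  have hε0 : 0 < ε := by positivity
  refine ⟨(1 + 1 / ε) ^ r, fun m => ?_⟩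
  have hx : (1 : ℝ) ≤ (m : ℝ) + 1 := by
    have : (0 : ℝ) ≤ m := m.cast_nonneg
    linarith
  have hH : (harmonic (m + 1) : ℝ) ≤ (1 + 1 / ε) * ((m : ℝ) + 1) ^ ε := by
    have h1 := harmonic_le_one_add_log (m + 1)
    have h2 := Real.log_le_rpow_div (zero_le_one.trans hx) hε0
    have h3 := Real.one_le_rpow hx hε0.le
    push_cast at h1
    rw [add_mul, one_mul, one_div_mul_eq_div]
    linarith
  calc (harmonic (m + 1) : ℝ) ^ r ≤ ((1 + 1 / ε) * ((m : ℝ) + 1) ^ ε) ^ r :=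
        pow_le_pow_left₀ (harmonic_cast_nonneg _) hH r
    _ = (1 + 1 / ε) ^ r * ((m : ℝ) + 1) ^ (ε * r) := by
        rw [mul_pow, Real.rpow_mul (by linarith), Real.rpow_natCast]
    _ ≤ (1 + 1 / ε) ^ r * ((m : ℝ) + 1) ^ (1 / 2 : ℝ) := by
        refine mul_le_mul_of_nonneg_left (Real.rpow_le_rpow_of_exponent_le hx ?_) (by positivity)
        rw [hε, div_mul_eq_mul_div, one_mul, div_le_div_iff₀ (by positivity) two_pos]
        linarith

theorem summable_coeff_innerGen_div (r t : ℕ) :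
    Summable fun m : ℕ =>
      PowerSeries.coeff r (innerGen m) / ((m : ℝ) + 1) ^ (2 * (t + 1)) := by
  obtain ⟨K, hK⟩ := exists_harmonic_pow_le r
  have hs : Summable fun m : ℕ => ((r : ℝ) + 1) * K * ((m : ℝ) + 1) ^ (-(3 / 2) : ℝ) := by
    refine Summable.mul_left _ ?_
    have h := (summable_nat_add_iff 1).2
      (Real.summable_nat_rpow.2 (show (-(3 / 2) : ℝ) < -1 by norm_num))
    simpa using h
  refine hs.of_nonneg_of_le (fun m => div_nonneg (coeff_innerGen_nonneg m r) (by positivity))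
    fun m => ?_
  have hx0 : (0 : ℝ) < (m : ℝ) + 1 := by positivity
  have hx : (1 : ℝ) ≤ (m : ℝ) + 1 := by
    have : (0 : ℝ) ≤ m := m.cast_nonneg
    linarith
  calc PowerSeries.coeff r (innerGen m) / ((m : ℝ) + 1) ^ (2 * (t + 1))
      ≤ PowerSeries.coeff r (innerGen m) / ((m : ℝ) + 1) ^ 2 :=
        div_le_div_of_nonneg_left (coeff_innerGen_nonneg m r) (by positivity)
          (pow_le_pow_right₀ hx (by omega))
    _ ≤ ((r : ℝ) + 1) * (K * ((m : ℝ) + 1) ^ (1 / 2 : ℝ)) / ((m : ℝ) + 1) ^ 2 := by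
        refine div_le_div_of_nonneg_right ((coeff_innerGen_le m r).trans ?_) (by positivity)
        exact mul_le_mul_of_nonneg_left (hK m) (by positivity)
    _ = ((r : ℝ) + 1) * K * ((m : ℝ) + 1) ^ (-(3 / 2) : ℝ) := by
        rw [show (-(3 / 2) : ℝ) = 1 / 2 - (2 : ℕ) by norm_num, Real.rpow_sub hx0,
          Real.rpow_natCast]
        ring

/-! ### Passage to the limit -/

theorem tendsto_connectedSum (r t : ℕ) :
    Filter.Tendsto (connectedSum r (t + 1)) Filter.atTop
      (nhds (2 * ∑' m : ℕ, (-1 : ℝ) ^ m * PowerSeries.coeff r (innerGen m) /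
        ((m : ℝ) + 1) ^ (2 * (t + 1)))) := by
  have h : ∀ N, connectedSum r (t + 1) N = 2 * ∑' m : ℕ, if m < N then
      (-1 : ℝ) ^ m * connector N (m + 1) * PowerSeries.coeff r (innerGen m) /
        ((m : ℝ) + 1) ^ (2 * (t + 1)) else 0 := by
    intro N
    rw [tsum_eq_sum (s := range N) fun m hm => if_neg (by simpa using hm), connectedSum]
    congr 1
    exact sum_congr rfl fun m hm => (if_pos (mem_range.1 hm)).symm
  rw [funext h]
  refine Filter.Tendsto.const_mul 2 ?_
  refine tendsto_tsum_of_dominated_convergence (summable_coeff_innerGen_div r t) ?_ ?_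
  · intro m
    have h1 := (((tendsto_connector (m + 1)).const_mul ((-1 : ℝ) ^ m)).mul_const
      (PowerSeries.coeff r (innerGen m))).div_const (((m : ℝ) + 1) ^ (2 * (t + 1)))
    rw [mul_one] at h1
    refine h1.congr' ?_
    filter_upwards [Filter.eventually_gt_atTop m] with N hN
    rw [if_pos hN]
  · refine Filter.Eventually.of_forall fun N m => ?_
    have hc := coeff_innerGen_nonneg m r
    split_ifs
    · rw [Real.norm_eq_abs, abs_div, abs_mul, abs_mul, abs_pow, abs_neg, abs_one, one_pow,
        one_mul, abs_of_nonneg hc, abs_of_pos (by positivity : (0 : ℝ) < _ ^ (2 * (t + 1)))]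
      exact div_le_div_of_nonneg_right
        (mul_le_of_le_one_left hc (abs_connector_le_one _ _)) (by positivity)
    · rw [norm_zero]
      positivity

/-- The tuples `0 < m₁ ≤ ⋯ ≤ mₙ ≤ N` as elements of the summation range. -/
def starIndexEmb (n N : ℕ) : {l : Fin n → Fin N // Monotone l} ↪ StarIndex n where
  toFun l := ⟨fun i => (l.1 i : ℕ) + 1, fun _ => Nat.succ_pos _,
    fun _ _ hij => Nat.succ_le_succ (l.2 hij)⟩
  inj' l l' h := by
    refine Subtype.ext (funext fun i => Fin.ext ?_)
    have := congrFun (congrArg Subtype.val h) i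
    exact Nat.succ_injective this

open Classical in
/-- The finite set of the tuples `0 < m₁ ≤ ⋯ ≤ mₙ ≤ N`. -/
def starIndexBox (n N : ℕ) : Finset (StarIndex n) := univ.map (starIndexEmb n N)

theorem mem_starIndexBox {n N : ℕ} {m : StarIndex n} :
    m ∈ starIndexBox n N ↔ ∀ i, m.1 i ≤ N := by
  simp only [starIndexBox, mem_map, mem_univ, true_and]
  constructor
  · rintro ⟨l, rfl⟩ i
    exact (l.1 i).2
  · intro h
    have h1 := m.2.1
    refine ⟨⟨fun i => ⟨m.1 i - 1, by have := h i; have := h1 i; omega⟩, fun i j hij => ?_⟩, ?_⟩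
    · exact Nat.sub_le_sub_right (m.2.2 hij) 1
    · exact Subtype.ext (funext fun i => Nat.sub_add_cancel (h1 i))

theorem sum_starIndexBox {n : ℕ} (k : Fin n → ℕ) (N : ℕ) :
    ∑ m ∈ starIndexBox n N, mzsvTerm k m = starTrunc N k := by
  classical
  rw [starIndexBox, sum_map, starTrunc,
    Finset.sum_subtype (p := fun l : Fin n → Fin N => Monotone l) _ (by simp)]
  refine sum_congr (by congr) fun l _ => ?_
  simp only [mzsvTerm, ← Nat.cast_succ]
  rfl

theorem tendsto_starIndexBox (n : ℕ) :
    Filter.Tendsto (starIndexBox n) Filter.atTop Filter.atTop := by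
  refine Filter.tendsto_atTop_finset_of_monotone (fun N N' h m hm => ?_) fun m => ?_
  · rw [mem_starIndexBox] at hm ⊢
    exact fun i => (hm i).trans h
  · refine ⟨∑ i, m.1 i, mem_starIndexBox.2 fun i => ?_⟩
    exact single_le_sum (f := m.1) (fun _ _ => Nat.zero_le _) (mem_univ i)

theorem mzsvTerm_nonneg {n : ℕ} (k : Fin n → ℕ) (m : StarIndex n) : 0 ≤ mzsvTerm k m := by
  unfold mzsvTerm
  positivity

/-- The boxes exhaust the index set and the terms are nonnegative, so bounded box sums force
summability and their limit is the sum. -/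
theorem hasSum_mzsvTerm_of_tendsto {n : ℕ} {k : Fin n → ℕ} {L : ℝ}
    (h : Filter.Tendsto (fun N => starTrunc N k) Filter.atTop (nhds L)) :
    HasSum (mzsvTerm k) L := by
  have hsum : Summable (mzsvTerm k) := by
    obtain ⟨c, hc⟩ := h.bddAbove_range
    refine summable_of_sum_le (c := c) (mzsvTerm_nonneg k) fun s => ?_
    obtain ⟨N, hN⟩ := ((tendsto_starIndexBox n).eventually_ge_atTop s).exists
    refine (sum_le_sum_of_subset_of_nonneg hN fun _ _ _ => mzsvTerm_nonneg k _).trans ?_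
    rw [sum_starIndexBox]
    exact hc ⟨N, rfl⟩
  have h2 := hsum.hasSum.comp (tendsto_starIndexBox n)
  have h3 : Filter.Tendsto (fun N => starTrunc N k) Filter.atTop
      (nhds (∑' m, mzsvTerm k m)) := by
    refine h2.congr fun N => ?_
    exact sum_starIndexBox k N
  rw [tendsto_nhds_unique h h3]
  exact hsum.hasSum

end

theorem mainTheorem4 (r s : ℕ) (hs : 1 ≤ s) :
    Summable (mzsvTerm (consIndex (r + 2) (constIndex (s - 1) 2))) ∧
    Summable (fun m : ℕ => (-1 : ℝ) ^ m / ((m : ℝ) + 1) ^ (2 * s) *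
      ∑ i ∈ Finset.range (r + 1),
        harmS m (constIndex (r - i) 1) * harmSStar m (constIndex i 1)) ∧
    mzsv (consIndex (r + 2) (constIndex (s - 1) 2)) =
      2 * ∑' m : ℕ, (-1 : ℝ) ^ m / ((m : ℝ) + 1) ^ (2 * s) *
        ∑ i ∈ Finset.range (r + 1),
          harmS m (constIndex (r - i) 1) * harmSStar m (constIndex i 1) := by
  obtain ⟨t, rfl⟩ : ∃ t, s = t + 1 := ⟨s - 1, by omega⟩
  rw [Nat.add_sub_cancel]
  simp only [← coeff_innerGen, div_mul_eq_mul_div]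
  have hlim := tendsto_connectedSum r t
  rw [← funext (starTrunc_eq_connectedSum r t)] at hlim
  have h := hasSum_mzsvTerm_of_tendsto hlim
  refine ⟨h.summable, ?_, h.tsum_eq⟩
  refine Summable.of_norm_bounded (summable_coeff_innerGen_div r t) fun m => ?_
  rw [Real.norm_eq_abs, abs_div, abs_mul, abs_pow, abs_neg, abs_one, one_pow, one_mul,
    abs_of_nonneg (coeff_innerGen_nonneg m r),
    abs_of_pos (by positivity : (0 : ℝ) < _ ^ (2 * (t + 1)))]
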